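/- Let $[\omega]^\omega$ be the set of infinite subsets of $\omega$, with the topology induced from the Cantor space $2^\omega$ by identifying a set with its characteristic function, and let $\mathsf S:[\omega]^\omega\to[\omega]^\omega$, $\mathsf S(X)=X\setminus\{\min X\}$. Let $\mathcal D_{\mathsf S}$ be the directed graph on $[\omega]^\omega$ with an edge from $X$ to $Y$ iff $X\neq Y$ and $\mathsf S(X)=Y$, and let $\mathcal G_{\mathsf S}$ be the graph on $[\omega]^\omega$ in which $X,Y$ are adjacent iff $X\ne Y$ and ($\mathsf S(X)=Y$ or $\mathsf S(Y)=X$). A homomorphism from $(X,R)$ to $(X',R')$ is a map $h:X\to X'$ such that $(x,y)\in R$ implies $(h(x),h(y))\in R'$. A binary relation $Q\subseteq A\times A$ on a set $A$ is a better-binary-relation if for every continuous map $\varphi:[\omega]^\omega\to A$, where $A$ is discrete, there is $X\in[\omega]^\omega$ with $(\varphi(X),\varphi(\mathsf S(X)))\in Q$. For a binary relation $P$ on $\omega$, let $\operatorname{unf}(P)\subseteq[\omega]^\omega$ be the set of those infinite sets whose increasing enumeration $(n_i)_{i\in\omega}$ satisfies $n_i\mathrel P n_{i+1}$ for all $i\in\omega$,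 with the subspace topology; $\mathcal D_{\mathsf S}|\operatorname{unf}(P)$ and $\mathcal G_{\mathsf S}|\operatorname{unf}(P)$ are the restrictions of $\mathcal D_{\mathsf S}$ and $\mathcal G_{\mathsf S}$ to the vertex set $\operatorname{unf}(P)$. Let $P\subseteq\omega\times\omega$ be an irreflexive binary relation on $\omega$. Then the following are equivalent: 1. the complement $P^{\complement}=(\omega\times\omega)\setminus P$ is not a better-binary-relation; 2. there exists a continuous homomorphism from $\mathcal D_{\mathsf S}$ to $(\omega,P)$, where $\omega$ is discrete; 3. there exists a continuous homomorphism from $\mathcal D_{\mathsf S}$ to $\mathcal D_{\mathsf S}|\operatorname{unf}(P)$; 4. there exists a Borel homomorphism from $\mathcal G_{\mathsf S}$ to $\mathcal G_{\mathsf S}|\operatorname{unf}(P)$. -/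

import Mathlib

/-- The set `[ω]^ω` of infinite sets of natural numbers. -/
def InfSub : Type := {A : Set ℕ // A.Infinite}

namespace InfSub

/-- The topology induced from the Cantor space, a set being identified with its
characteristic function. -/
noncomputable instance : TopologicalSpace InfSub :=
  TopologicalSpace.induced (fun A : InfSub => (A.1.boolIndicator : ℕ → Bool)) inferInstance

/-- The shift operation: remove the least element. -/
noncomputable def shift (A : InfSub) : InfSub :=
  ⟨A.1 \ {sInf A.1}, A.2.sdiff (Set.finite_singleton _)⟩

/-- The strictly increasing enumeration of the elements of an infinite set. -/
noncomputable def enum (A : InfSub) (i : ℕ) : ℕ := Nat.nth (· ∈ A.1) i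

end InfSub

/-- The edge relation of the directed graph `D_f` generated by a function `f`. -/
def dirGraph {X : Type*} (f : X → X) (x y : X) : Prop := x ≠ y ∧ f x = y

/-- The edge relation of the graph `G_f`, the symmetric counterpart of `D_f`. -/
def symGraph {X : Type*} (f : X → X) (x y : X) : Prop := x ≠ y ∧ (f x = y ∨ f y = x)

/-- The infinite sets whose consecutive elements (in increasing order) are related by `P`. -/
def unf (P : ℕ → ℕ → Prop) : Set InfSub :=
  {A | ∀ i, P (A.enum i) (A.enum (i + 1))}

/-- The restriction of a (directed) graph with edge relation `R` to a set `Y` of vertices. -/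
def restrictGraph {X : Type*} (R : X → X → Prop) (Y : Set X) (x y : Y) : Prop :=
  R (x : X) (y : X)

/-- Borel maps between topological spaces: preimages of Borel sets are Borel. -/
def IsBorelMap {X Y : Type*} [TopologicalSpace X] [TopologicalSpace Y] (f : X → Y) : Prop :=
  @Measurable X Y (borel X) (borel Y) f

/-- A binary relation `R` on a set `A` is a better-binary-relation if every continuous map from
`[ω]^ω` to the discrete space `A` satisfies `φ(X) R φ(S(X))` for some `X`. -/
def IsBetterBinaryRelation {A : Type*} (R : A → A → Prop) : Prop :=
  ∀ φ : InfSub → A, @Continuous InfSub A _ ⊥ φ → ∃ X : InfSub, R (φ X) (φ X.shift)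

/-- There is a continuous homomorphism from `(X, R)` to `(Y, T)`. -/
def ExistsContinuousHom {X Y : Type*} [TopologicalSpace X] [TopologicalSpace Y]
    (R : X → X → Prop) (T : Y → Y → Prop) : Prop :=
  ∃ h : R →r T, Continuous h

/-- There is a Borel homomorphism from `(X, R)` to `(Y, T)`. -/
def ExistsBorelHom {X Y : Type*} [TopologicalSpace X] [TopologicalSpace Y]
    (R : X → X → Prop) (T : Y → Y → Prop) : Prop :=
  ∃ h : R →r T, IsBorelMap h

namespace InfSub

/-! Since `A ≠ A.shift` always, (1) and (2) both ask for a continuous `φ` with `P (φ A) (φ A.shift)`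
for every `A`. The other implications use Galvin–Prikry: a Borel set of infinite sets contains or
misses all infinite subsets of some `X`. Relabelling by the enumeration of `X` (`transfer`) commutes
with the shift, so the good behaviour below `X` spreads to all of `[ω]^ω`. (2) → (3): natural
numbers cannot decrease forever along shifts, so `φ` may be taken strictly increasing along them;
then `A` is sent to the set of values of `φ` on its iterated shifts. (4) → (2): colour `A` by the
minimum of its image. The same descent argument makes edges point forward, and a Ramsey argument
turns the Borel colouring into a continuous one. -/

theorem sInf_mem (A : InfSub) : sInf A.1 ∈ A.1 := Nat.sInf_mem A.2.nonempty

theorem mem_shift_iff_ne {A : InfSub} {k : ℕ} : k ∈ A.shift.1 ↔ k ∈ A.1 ∧ k ≠ sInf A.1 := by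
  simp [shift]

theorem shift_subset (A : InfSub) : A.shift.1 ⊆ A.1 := Set.sdiff_subset

theorem sInf_lt_of_mem_shift {A : InfSub} {k : ℕ} (h : k ∈ A.shift.1) : sInf A.1 < k := by
  rw [mem_shift_iff_ne] at h
  exact lt_of_le_of_ne (Nat.sInf_le h.1) (Ne.symm h.2)

theorem mem_shift {A : InfSub} {k : ℕ} : k ∈ A.shift.1 ↔ k ∈ A.1 ∧ ∃ j < k, j ∈ A.1 := by
  constructor
  · intro h
    exact ⟨A.shift_subset h, _, sInf_lt_of_mem_shift h, A.sInf_mem⟩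
  · rintro ⟨h, j, hj, hjA⟩
    exact mem_shift_iff_ne.2 ⟨h, ((Nat.sInf_le hjA).trans_lt hj).ne'⟩

theorem sInf_lt_sInf_shift (A : InfSub) : sInf A.1 < sInf A.shift.1 :=
  sInf_lt_of_mem_shift A.shift.sInf_mem

theorem ne_shift (A : InfSub) : A ≠ A.shift := fun h =>
  (congrArg (fun B : InfSub => sInf B.1) h).not_lt A.sInf_lt_sInf_shift

/-! ### Ellentuck boxes -/

/-- The elements of `X` that lie above every element of `s`. -/
def tail (X : Set ℕ) (s : Finset ℕ) : Set ℕ := {x ∈ X | ∀ y ∈ s, y < x}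

theorem tail_subset (X : Set ℕ) (s : Finset ℕ) : tail X s ⊆ X := fun _ h => h.1

theorem tail_mono {X Y : Set ℕ} (h : X ⊆ Y) (s : Finset ℕ) : tail X s ⊆ tail Y s :=
  fun _ hx => ⟨h hx.1, hx.2⟩

theorem tail_infinite {X : Set ℕ} (hX : X.Infinite) (s : Finset ℕ) : (tail X s).Infinite := by
  refine (hX.sdiff (Set.finite_Iic (s.sup id))).mono fun x hx => ⟨hx.1, fun y hy => ?_⟩
  exact (Finset.le_sup (f := id) hy).trans_lt (not_le.1 hx.2)

/-- The basic open set of the Ellentuck topology: the infinite sets with initial segment `s`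
whose other elements belong to `X`. -/
def box (s : Finset ℕ) (X : Set ℕ) : Set InfSub := {W | ↑s ⊆ W.1 ∧ W.1 ⊆ ↑s ∪ tail X s}

theorem box_mono {X Y : Set ℕ} (h : X ⊆ Y) (s : Finset ℕ) : box s X ⊆ box s Y :=
  fun _ hW => ⟨hW.1, hW.2.trans (Set.union_subset_union_right _ (tail_mono h s))⟩

theorem box_tail (X : Set ℕ) (s : Finset ℕ) : box s (tail X s) = box s X := by
  have : tail (tail X s) s = tail X s := Set.ext fun x => ⟨fun h => h.1, fun h => ⟨h, h.2⟩⟩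
  simp only [box, this]

theorem mem_box_empty {X : Set ℕ} {W : InfSub} : W ∈ box ∅ X ↔ W.1 ⊆ X := by
  simp [box, tail]

theorem exists_mem_box_insert {C : Set ℕ} {s : Finset ℕ} {W : InfSub} (hW : W ∈ box s C) :
    ∃ n ∈ C, W ∈ box (insert n s) C := by
  have hne : (W.1 \ ↑s).Nonempty := (W.2.sdiff s.finite_toSet).nonempty
  have hn := Nat.sInf_mem hne
  have hle : ∀ w ∈ W.1 \ ↑s, sInf (W.1 \ ↑s) ≤ w := fun w hw => Nat.sInf_le hw
  generalize sInf (W.1 \ ↑s) = n at hn hle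
  refine ⟨n, ((hW.2 hn.1).resolve_left hn.2).1, ?_, fun w hw => ?_⟩
  · rw [Finset.coe_insert]
    exact Set.insert_subset hn.1 hW.1
  · rw [Finset.coe_insert]
    by_cases hws : w ∈ (s : Set ℕ)
    · exact Or.inl (Or.inr hws)
    · rcases (hle w ⟨hw, hws⟩).eq_or_lt with h | h
      · exact Or.inl (Or.inl h.symm)
      · have := (hW.2 hw).resolve_left hws
        refine Or.inr ⟨this.1, fun y hy => ?_⟩
        rcases Finset.mem_insert.1 hy with rfl | hy
        exacts [h, this.2 y hy]

theorem exists_long_initial_segment {X : Set ℕ} {s₀ : Finset ℕ} {W : InfSub}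
    (hW : W ∈ box s₀ X) (N : ℕ) : ∃ s, s₀ ⊆ s ∧ N ≤ s.sup id ∧ W ∈ box s X := by
  classical
  obtain ⟨m, hmW, hm⟩ := W.2.exists_gt (N + s₀.sup id)
  have hs₀ : s₀ ⊆ (Finset.range (m + 1)).filter (· ∈ W.1) := fun x hx => by
    have : x ≤ s₀.sup id := Finset.le_sup (f := id) hx
    exact Finset.mem_filter.2 ⟨Finset.mem_range.2 (by omega), hW.1 hx⟩
  refine ⟨(Finset.range (m + 1)).filter (· ∈ W.1), hs₀, ?_, ?_, ?_⟩
  · have : m ≤ ((Finset.range (m + 1)).filter (· ∈ W.1)).sup id :=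
      Finset.le_sup (f := id) (Finset.mem_filter.2 ⟨Finset.self_mem_range_succ m, hmW⟩)
    omega
  · intro x hx
    exact (Finset.mem_filter.1 hx).2
  · intro w hw
    by_cases hwm : w ≤ m
    · exact Or.inl (Finset.mem_coe.2 (Finset.mem_filter.2 ⟨Finset.mem_range.2 (by omega), hw⟩))
    · refine Or.inr ⟨?_, fun y hy => ?_⟩
      · refine ((hW.2 hw).resolve_left fun h => hwm ?_).1
        have := Finset.mem_range.1 (Finset.mem_filter.1 (hs₀ h)).1
        omega
      · have := Finset.mem_range.1 (Finset.mem_filter.1 hy).1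
        omega

/-! ### Fusion of shrinking sequences -/

section Fusion

variable {Φ : Finset ℕ → Set ℕ → Prop} {Y : InfSub}

theorem exists_forall_finset (hmono : ∀ s (A B : Set ℕ), A ⊆ B → Φ s B → Φ s A)
    (hdense : ∀ s (A : InfSub), A.1 ⊆ Y.1 → ∃ B : InfSub, B.1 ⊆ A.1 ∧ Φ s B.1)
    (T : Finset (Finset ℕ)) (A : InfSub) (hA : A.1 ⊆ Y.1) :
    ∃ B : InfSub, B.1 ⊆ A.1 ∧ ∀ s ∈ T, Φ s B.1 := by
  classical
  induction T using Finset.induction_on with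
  | empty => exact ⟨A, subset_rfl, by simp⟩
  | insert s T _ ih =>
    obtain ⟨B, hBA, hB⟩ := ih
    obtain ⟨C, hCB, hC⟩ := hdense s B (hBA.trans hA)
    refine ⟨C, hCB.trans hBA, fun t ht => ?_⟩
    rcases Finset.mem_insert.1 ht with rfl | ht
    exacts [hC, hmono _ _ _ hCB (hB t ht)]

/-- Diagonalisation: at each stage the reservoir is shrunk to satisfy `Φ` for all subsets of the
finite set `F n` chosen so far, and its minimum is then added. A finite `s` is handled at the first
stage containing it, and its tail lies in that reservoir. -/
theorem fusion (hmono : ∀ s (A B : Set ℕ), A ⊆ B → Φ s B → Φ s A)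
    (hdense : ∀ s (A : InfSub), A.1 ⊆ Y.1 → ∃ B : InfSub, B.1 ⊆ A.1 ∧ Φ s B.1)
    (s₀ : Finset ℕ) :
    ∃ X : InfSub, X.1 ⊆ Y.1 ∧ ∀ s : Finset ℕ, ↑s ⊆ ↑s₀ ∪ X.1 → Φ s (tail X.1 s) := by
  classical
  have step : ∀ (F : Finset ℕ) (A : {A : InfSub // A.1 ⊆ Y.1}),
      ∃ B : {A : InfSub // A.1 ⊆ Y.1}, B.1.1 ⊆ A.1.1 ∧ ∀ s ⊆ F, Φ s B.1.1 := fun F A => by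
    obtain ⟨B, hBA, hB⟩ := exists_forall_finset hmono hdense F.powerset A.1 A.2
    exact ⟨⟨B, hBA.trans A.2⟩, hBA, fun s hs => hB s (Finset.mem_powerset.2 hs)⟩
  choose g hg hgΦ using step
  let next : Finset ℕ × {A : InfSub // A.1 ⊆ Y.1} → Finset ℕ × {A : InfSub // A.1 ⊆ Y.1} :=
    fun p => (insert (sInf p.2.1.1) p.1,
      g (insert (sInf p.2.1.1) p.1) ⟨p.2.1.shift, p.2.1.shift_subset.trans p.2.2⟩)
  let q : ℕ → Finset ℕ × {A : InfSub // A.1 ⊆ Y.1} :=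
    fun n => next^[n] (s₀, g s₀ ⟨Y, subset_rfl⟩)
  have hq : ∀ n, q (n + 1) = next (q n) := fun n => Function.iterate_succ_apply' _ _ _
  let A : ℕ → InfSub := fun n => (q n).2.1
  let F : ℕ → Finset ℕ := fun n => (q n).1
  let x : ℕ → ℕ := fun n => sInf (A n).1
  have hF : ∀ n, F (n + 1) = insert (x n) (F n) := fun n => by simp only [F, hq]; rfl
  have hAs : ∀ n, (A (n + 1)).1 ⊆ (A n).shift.1 := fun n => by
    simp only [A, hq]; exact hg _ _
  have hAΦ : ∀ n, ∀ s ⊆ F n, Φ s (A n).1 := fun n => by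
    cases n with
    | zero => exact hgΦ _ _
    | succ n => simp only [A, F, hq]; exact hgΦ _ _
  have hanti : ∀ m n, m ≤ n → (A n).1 ⊆ (A m).1 := fun m n h =>
    antitone_nat_of_succ_le (f := fun n => (A n).1)
      (fun n => (hAs n).trans (A n).shift_subset) h
  have hx : StrictMono x := strictMono_nat_of_lt_succ fun n =>
    sInf_lt_of_mem_shift (hAs n (A (n + 1)).sInf_mem)
  have hxA : ∀ m n, m ≤ n → x n ∈ (A m).1 := fun m n h => hanti m n h (A n).sInf_mem
  have hFmono : Monotone F := monotone_nat_of_le_succ fun n => by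
    rw [hF]; exact Finset.subset_insert _ _
  refine ⟨⟨Set.range x, Set.infinite_range_of_injective hx.injective⟩, ?_, fun s hs => ?_⟩
  · rintro _ ⟨n, rfl⟩
    exact (q n).2.2 (A n).sInf_mem
  · have hex : ∃ n, s ⊆ F n := by
      have : ∀ t : Finset ℕ, t ⊆ s → ∃ n, t ⊆ F n := fun t => by
        induction t using Finset.induction_on with
        | empty => exact fun _ => ⟨0, by simp⟩
        | insert a t _ ih =>
          intro h
          obtain ⟨n, hn⟩ := ih ((Finset.subset_insert _ _).trans h)
          rcases hs (h (Finset.mem_insert_self a t)) with ha | ⟨k, rfl⟩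
          · exact ⟨n, Finset.insert_subset (hFmono (Nat.zero_le n) ha) hn⟩
          · refine ⟨max n (k + 1), Finset.insert_subset ?_ (hn.trans (hFmono (le_max_left _ _)))⟩
            refine hFmono (le_max_right n (k + 1)) ?_
            rw [hF]; exact Finset.mem_insert_self _ _
      exact this s subset_rfl
    refine hmono _ _ _ ?_ (hAΦ _ s (Nat.find_spec hex))
    rintro _ ⟨⟨k, rfl⟩, hk⟩
    -- If `x k` came before that first stage, minimality would put the last point added, `x (k + m)
    -- ≥ x k`, in `s`, so `x k` could not lie above `s`.
    refine hxA _ _ (not_lt.1 fun hlt => ?_)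
    obtain ⟨m, hm⟩ := Nat.exists_eq_add_of_lt hlt
    have hs₁ : s ⊆ insert (x (k + m)) (F (k + m)) := by
      rw [← hF, ← hm]; exact Nat.find_spec hex
    have hs₂ : x (k + m) ∈ s := by
      by_contra hnot
      refine Nat.find_min hex (by omega : k + m < Nat.find hex) fun y hy => ?_
      exact (Finset.mem_insert.1 (hs₁ hy)).resolve_left fun h => hnot (h ▸ hy)
    exact (hx.monotone (Nat.le_add_right k m)).not_gt (hk _ hs₂)

end Fusion

/-! ### Completely Ramsey sets -/

/-- A set of infinite sets is completely Ramsey if below every Ellentuck box there is a box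
with the same initial segment which it contains or misses. -/
def CompletelyRamsey (B : Set InfSub) : Prop :=
  ∀ (s : Finset ℕ) (Y : InfSub), ∃ X : InfSub, X.1 ⊆ Y.1 ∧ (box s X.1 ⊆ B ∨ box s X.1 ⊆ Bᶜ)

theorem CompletelyRamsey.compl {B : Set InfSub} (h : CompletelyRamsey B) :
    CompletelyRamsey Bᶜ := fun s Y => by
  obtain ⟨X, hX, hB⟩ := h s Y
  exact ⟨X, hX, by rwa [compl_compl, or_comm]⟩

theorem completelyRamsey_empty : CompletelyRamsey ∅ := fun _ Y => ⟨Y, subset_rfl, by simp⟩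

theorem completelyRamsey_mem (n : ℕ) : CompletelyRamsey {W | n ∈ W.1} := fun s Y => by
  refine ⟨⟨tail Y.1 {n}, tail_infinite Y.2 _⟩, tail_subset _ _, ?_⟩
  by_cases hn : n ∈ s
  · exact Or.inl fun W hW => hW.1 hn
  · refine Or.inr fun W hW hnW => ?_
    rcases hW.2 hnW with h | h
    · exact hn h
    · exact (h.1.2 n (Finset.mem_singleton_self n)).false

/-- On a suitable infinite set, the members of a sequence of completely Ramsey sets are all
decided by finite initial segments. -/
theorem exists_forall_box_decided {B : ℕ → Set InfSub} (hB : ∀ n, CompletelyRamsey (B n))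
    (s₀ : Finset ℕ) (Y : InfSub) :
    ∃ X : InfSub, X.1 ⊆ Y.1 ∧ ∀ s : Finset ℕ, ↑s ⊆ ↑s₀ ∪ X.1 → ∀ n ≤ s.sup id,
      box s X.1 ⊆ B n ∨ box s X.1 ⊆ (B n)ᶜ := by
  have key := fusion (Y := Y)
    (Φ := fun s A => ∀ n ≤ s.sup id, box s A ⊆ B n ∨ box s A ⊆ (B n)ᶜ)
    (fun s A A' h hA' n hn => (hA' n hn).imp (box_mono h s).trans (box_mono h s).trans)
    (fun s A _ => by
      have : ∀ N, ∃ C : InfSub, C.1 ⊆ A.1 ∧ ∀ n ≤ N, box s C.1 ⊆ B n ∨ box s C.1 ⊆ (B n)ᶜ := by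
        intro N
        induction N with
        | zero =>
          obtain ⟨C, hC, h⟩ := hB 0 s A
          exact ⟨C, hC, fun n hn => by rwa [Nat.le_zero.1 hn]⟩
        | succ N ih =>
          obtain ⟨C, hC, h⟩ := ih
          obtain ⟨D, hD, h'⟩ := hB (N + 1) s C
          refine ⟨D, hD.trans hC, fun n hn => ?_⟩
          rcases Nat.le_succ_iff.1 hn with hn | rfl
          · exact (h n hn).imp (box_mono hD s).trans (box_mono hD s).trans
          · exact h'
      exact this _) s₀
  simpa only [box_tail] using key

/-- The Ellentuck theorem for sets that are open relative to a box. -/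
theorem exists_homogeneous_of_open {B : Set InfSub} {s₀ : Finset ℕ} {Y : InfSub}
    (hB : ∀ W ∈ B, W ∈ box s₀ Y.1 → ∃ s : Finset ℕ, s₀ ⊆ s ∧ ↑s ⊆ W.1 ∧ box s Y.1 ⊆ B) :
    ∃ X : InfSub, X.1 ⊆ Y.1 ∧ (box s₀ X.1 ⊆ B ∨ box s₀ X.1 ⊆ Bᶜ) := by
  classical
  -- `X₁` accepts or rejects each `s`: its box lies in `B`, or no smaller box at `s` does.
  obtain ⟨X₁, hX₁, h₁⟩ := fusion (Y := Y)
    (Φ := fun s A => box s A ⊆ B ∨ ∀ C : InfSub, C.1 ⊆ A → ¬ box s C.1 ⊆ B)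
    (fun s A A' h hA' => hA'.imp (box_mono h s).trans fun H C hC => H C (hC.trans h))
    (fun s A _ => by
      by_cases h : ∃ C : InfSub, C.1 ⊆ A.1 ∧ box s C.1 ⊆ B
      · obtain ⟨C, hC, h⟩ := h
        exact ⟨C, hC, Or.inl h⟩
      · push Not at h
        exact ⟨A, subset_rfl, Or.inr h⟩) s₀
  -- Below `X₂`, one-point extensions of a non-accepted `s` are not accepted either.
  obtain ⟨X₂, hX₂, h₂⟩ := fusion (Y := X₁)
    (Φ := fun s A => ↑s ⊆ ↑s₀ ∪ X₁.1 → box s X₁.1 ⊆ B ∨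
      ∀ n ∈ A, n ∈ tail X₁.1 s → ¬ box (insert n s) X₁.1 ⊆ B)
    (fun s A A' h hA' hs => (hA' hs).imp_right fun H n hn => H n (h hn))
    (fun s A hA => by
      by_cases hs : (s : Set ℕ) ⊆ ↑s₀ ∪ X₁.1
      swap
      · exact ⟨A, subset_rfl, fun h => absurd h hs⟩
      rcases h₁ s hs with h | h
      · exact ⟨A, subset_rfl, fun _ => Or.inl (by rwa [box_tail] at h)⟩
      · set C : Set ℕ := {n ∈ A.1 | n ∈ tail X₁.1 s ∧ box (insert n s) X₁.1 ⊆ B} with hC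
        -- An infinite set of accepted one-point extensions would itself give a box at `s` inside
        -- `B`, against rejection.
        have hfin : C.Finite := by
          by_contra hinf
          refine h ⟨C, hinf⟩ (fun n hn => hn.2.1) fun W hW => ?_
          obtain ⟨n, hn, hWn⟩ := exists_mem_box_insert hW
          exact hn.2.2 (box_mono (fun k hk => hk.2.1.1) _ hWn)
        exact ⟨⟨A.1 \ C, A.2.sdiff hfin⟩, Set.sdiff_subset, fun _ => Or.inr fun n hn hnt hb =>
          hn.2 ⟨hn.1, hnt, hb⟩⟩) s₀
  refine ⟨X₂, hX₂.trans hX₁, ?_⟩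
  by_cases hacc : box s₀ X₁.1 ⊆ B
  · exact Or.inl ((box_mono hX₂ _).trans hacc)
  have hrej : ∀ t : Finset ℕ, ↑t ⊆ tail X₂.1 s₀ → ¬ box (s₀ ∪ t) X₁.1 ⊆ B := fun t => by
    induction t using Finset.induction_on_max with
    | empty => simpa using hacc
    | insert a t ha ih =>
      intro h
      rw [Finset.coe_insert, Set.insert_subset_iff] at h
      have hst : ((s₀ ∪ t : Finset ℕ) : Set ℕ) ⊆ ↑s₀ ∪ X₂.1 := by
        rw [Finset.coe_union]
        exact Set.union_subset_union_right _ (h.2.trans (tail_subset _ _))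
      have hat : a ∈ tail X₂.1 (s₀ ∪ t) := ⟨h.1.1, fun y hy =>
        (Finset.mem_union.1 hy).elim (h.1.2 y) (ha y)⟩
      have := (h₂ _ hst (hst.trans (Set.union_subset_union_right _ hX₂))).resolve_left (ih h.2)
        a hat (tail_mono hX₂ _ hat)
      rwa [Finset.union_insert]
  refine Or.inr fun W hW hWB => ?_
  obtain ⟨s, hs₀, hsW, hsB⟩ := hB W hWB (box_mono (hX₂.trans hX₁) _ hW)
  refine hrej (s \ s₀) (fun x hx => ?_) ?_
  · rw [Finset.mem_coe, Finset.mem_sdiff] at hx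
    exact (hW.2 (hsW hx.1)).resolve_left hx.2
  · rw [Finset.union_sdiff_of_subset hs₀]
    exact (box_mono hX₁ _).trans hsB

/-- After shrinking, an initial segment reaching past `n` decides `B n`, so the union is open
relative to the box and the open case applies. -/
theorem CompletelyRamsey.iUnion {B : ℕ → Set InfSub} (hB : ∀ n, CompletelyRamsey (B n)) :
    CompletelyRamsey (⋃ n, B n) := fun s₀ Y => by
  obtain ⟨X, hX, h⟩ := exists_forall_box_decided hB s₀ Y
  obtain ⟨Z, hZ, h'⟩ := exists_homogeneous_of_open (B := ⋃ n, B n) (s₀ := s₀) (Y := X)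
    fun W hWB hW => by
      obtain ⟨n, hn⟩ := Set.mem_iUnion.1 hWB
      obtain ⟨s, hs₀, hns, hWs⟩ := exists_long_initial_segment hW n
      refine ⟨s, hs₀, hWs.1, ?_⟩
      have hsX : (s : Set ℕ) ⊆ ↑s₀ ∪ X.1 := hWs.1.trans
        (hW.2.trans (Set.union_subset_union_right _ (tail_subset _ _)))
      exact ((h s hsX n hns).resolve_right fun h => h hWs hn).trans (Set.subset_iUnion B n)
  exact ⟨Z, hZ.trans hX, h'⟩

/-! ### Borel sets and continuity -/

theorem continuous_iff_isClopen {T : Type*} [TopologicalSpace T] {f : T → InfSub} :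
    Continuous f ↔ ∀ n, IsClopen {t | n ∈ (f t).1} := by
  rw [continuous_induced_rng, continuous_pi_iff]
  refine forall_congr' fun n => ?_
  rw [← continuous_boolIndicator_iff_isClopen]
  rfl

theorem isClopen_mem (n : ℕ) : IsClopen {A : InfSub | n ∈ A.1} :=
  continuous_iff_isClopen.1 continuous_id n

theorem completelyRamsey_of_borel {B : Set InfSub} (hB : @MeasurableSet InfSub (borel InfSub) B) :
    CompletelyRamsey B := by
  -- The completely Ramsey sets form a σ-algebra, so checking the coordinate sets suffices.
  let m : MeasurableSpace InfSub :=
    { MeasurableSet' := CompletelyRamsey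
      measurableSet_empty := completelyRamsey_empty
      measurableSet_compl := fun _ h => h.compl
      measurableSet_iUnion := fun _ h => CompletelyRamsey.iUnion h }
  suffices borel InfSub ≤ m from this B hB
  have h : borel InfSub = (borel (ℕ → Bool)).comap (fun A : InfSub => A.1.boolIndicator) :=
    borel_comap
  rw [h, ← measurable_iff_comap_le, ← BorelSpace.measurable_eq, measurable_pi_iff]
  exact fun n => measurable_to_bool (by
    convert! completelyRamsey_mem n
    ext A
    simp [Set.boolIndicator])


theorem continuous_shift : Continuous shift := continuous_iff_isClopen.2 fun n => by
  have : {A : InfSub | n ∈ A.shift.1} = {A | n ∈ A.1} ∩ ⋃ j ∈ Finset.range n, {A | j ∈ A.1} := by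
    ext A
    simp [mem_shift]
  rw [this]
  exact (isClopen_mem n).inter (Set.Finite.isClopen_biUnion (Finset.finite_toSet _)
    fun j _ => isClopen_mem j)

theorem continuous_sInf : Continuous fun A : InfSub => sInf A.1 := by
  refine continuous_discrete_rng.2 fun n => ?_
  have : (fun A : InfSub => sInf A.1) ⁻¹' {n} =
      {A | n ∈ A.1} ∩ ⋂ j ∈ Finset.range n, {A : InfSub | j ∈ A.1}ᶜ := by
    ext A
    simp only [Set.mem_preimage, Set.mem_singleton_iff, Set.mem_inter_iff, Set.mem_ofPred_eq,
      Set.mem_iInter, Finset.mem_range, Set.mem_compl_iff]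
    constructor
    · rintro rfl
      exact ⟨A.sInf_mem, fun j hj hjA => (Nat.sInf_le hjA).not_gt hj⟩
    · rintro ⟨hn, h⟩
      exact le_antisymm (Nat.sInf_le hn) (not_lt.1 fun hlt => h _ hlt A.sInf_mem)
  rw [this]
  exact ((isClopen_mem n).inter (Set.Finite.isClopen_biInter (Finset.finite_toSet _)
    fun j _ => (isClopen_mem j).compl)).isOpen

/-! ### Enumerations and relabelling -/

theorem enum_strictMono (A : InfSub) : StrictMono A.enum := Nat.nth_strictMono A.2

theorem enum_mem (A : InfSub) (i : ℕ) : A.enum i ∈ A.1 := Nat.nth_mem_of_infinite A.2 i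

theorem range_enum (A : InfSub) : Set.range A.enum = A.1 := Nat.range_nth_of_infinite A.2

theorem enum_eq_of_strictMono {A : InfSub} {a : ℕ → ℕ} (ha : StrictMono a)
    (hA : A.1 = Set.range a) : A.enum = a :=
  (StrictMono.range_inj A.enum_strictMono ha).1 (A.range_enum.trans hA)

theorem enum_zero (A : InfSub) : A.enum 0 = sInf A.1 := Nat.nth_zero

theorem shift_val_of_eq_range {A : InfSub} {a : ℕ → ℕ} (ha : StrictMono a)
    (hA : A.1 = Set.range a) : A.shift.1 = Set.range fun i => a (i + 1) := by
  ext k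
  rw [mem_shift, hA]
  constructor
  · rintro ⟨⟨i, rfl⟩, j, hj, l, rfl⟩
    have := ha.lt_iff_lt.1 hj
    exact ⟨i - 1, by simp only; congr 1; omega⟩
  · rintro ⟨i, rfl⟩
    exact ⟨⟨_, rfl⟩, a i, ha i.lt_succ_self, i, rfl⟩

theorem enum_shift (A : InfSub) (i : ℕ) : A.shift.enum i = A.enum (i + 1) :=
  congrFun (enum_eq_of_strictMono (fun _ _ h => A.enum_strictMono (by omega))
    (shift_val_of_eq_range A.enum_strictMono A.range_enum.symm)) i

/-- The copy of `A` inside `X` under the increasing bijection between `ω` and `X`. -/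
noncomputable def transfer (X A : InfSub) : InfSub :=
  ⟨X.enum '' A.1, A.2.image X.enum_strictMono.injective.injOn⟩

theorem transfer_subset (X A : InfSub) : (transfer X A).1 ⊆ X.1 := by
  rintro _ ⟨i, -, rfl⟩
  exact X.enum_mem i

theorem continuous_transfer (X : InfSub) : Continuous (transfer X) :=
  continuous_iff_isClopen.2 fun n => by
    by_cases h : ∃ i, X.enum i = n
    · obtain ⟨i, rfl⟩ := h
      convert! isClopen_mem i using 3
      exact X.enum_strictMono.injective.mem_set_image
    · convert! isClopen_empty
      ext A
      simp only [transfer, Set.mem_ofPred_eq, Set.mem_empty_iff_false, iff_false]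
      rintro ⟨i, -, hi⟩
      exact h ⟨i, hi⟩

theorem transfer_shift (X A : InfSub) : transfer X A.shift = (transfer X A).shift := by
  refine Subtype.ext (Set.ext fun k => ?_)
  rw [mem_shift]
  constructor
  · rintro ⟨i, hi, rfl⟩
    obtain ⟨hiA, j, hj, hjA⟩ := mem_shift.1 hi
    exact ⟨⟨i, hiA, rfl⟩, _, X.enum_strictMono hj, j, hjA, rfl⟩
  · rintro ⟨⟨i, hi, rfl⟩, _, hlt, j, hj, rfl⟩
    exact ⟨i, mem_shift.2 ⟨hi, j, X.enum_strictMono.lt_iff_lt.1 hlt, hj⟩, rfl⟩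

/-! ### Homogeneity and continuity for Borel colourings -/

/-- The Galvin–Prikry theorem. -/
theorem exists_homogeneous_of_borel {B : Set InfSub} (hB : @MeasurableSet InfSub (borel InfSub) B) :
    ∃ X : InfSub, (∀ A : InfSub, A.1 ⊆ X.1 → A ∈ B) ∨ ∀ A : InfSub, A.1 ⊆ X.1 → A ∉ B := by
  obtain ⟨X, -, h⟩ := completelyRamsey_of_borel hB ∅ ⟨Set.univ, Set.infinite_univ⟩
  exact ⟨X, h.imp (fun h A hA => h (mem_box_empty.2 hA)) fun h A hA => h (mem_box_empty.2 hA)⟩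

theorem mem_box_of_agree {X : Set ℕ} {s : Finset ℕ} {A B : InfSub} (hA : A ∈ box s X)
    (hB : B.1 ⊆ X) (h : ∀ n ≤ s.sup id, n ∈ B.1 ↔ n ∈ A.1) : B ∈ box s X := by
  refine ⟨fun n hn => (h n (Finset.le_sup (f := id) hn)).2 (hA.1 hn), fun n hn => ?_⟩
  by_cases hns : n ≤ s.sup id
  · exact hA.2 ((h n hns).1 hn)
  · exact Or.inr ⟨hB hn, fun y hy => (Finset.le_sup (f := id) hy).trans_lt (not_le.1 hns)⟩

theorem isOpen_agree (A : InfSub) (N : ℕ) : IsOpen {B : InfSub | ∀ n ≤ N, n ∈ B.1 ↔ n ∈ A.1} := by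
  have : {B : InfSub | ∀ n ≤ N, n ∈ B.1 ↔ n ∈ A.1} =
      ⋂ n ∈ Set.Iic N, {B : InfSub | n ∈ B.1 ↔ n ∈ A.1} := by
    ext B
    simp
  rw [this]
  refine (Set.finite_Iic N).isOpen_biInter fun n _ => ?_
  by_cases hn : n ∈ A.1
  · simpa only [hn, iff_true] using (isClopen_mem n).isOpen
  · simp only [hn, iff_false]
    exact (isClopen_mem n).compl.isOpen

/-- Every Borel colouring by natural numbers is continuous on the infinite subsets of some
infinite set. -/
theorem exists_continuous_comp_transfer {φ : InfSub → ℕ}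
    (hφ : @Measurable InfSub ℕ (borel InfSub) ⊤ φ) :
    ∃ X : InfSub, Continuous fun A => φ (transfer X A) := by
  obtain ⟨X, -, hX⟩ := exists_forall_box_decided (B := fun n => φ ⁻¹' {n})
    (fun n => completelyRamsey_of_borel (hφ trivial)) ∅ ⟨Set.univ, Set.infinite_univ⟩
  refine ⟨X, continuous_discrete_rng.2 fun n => isOpen_iff_forall_mem_open.2 fun A hA => ?_⟩
  have hAX := transfer_subset X A
  -- Reaching past the colour `n` of `A` makes `s` decide that colour class.
  obtain ⟨s, -, hns, hs⟩ := exists_long_initial_segment (mem_box_empty.2 hAX) n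
  have hbox := (hX s (by simpa using hs.1.trans hAX) n hns).resolve_right fun h => h hs hA
  exact ⟨_, fun B hB => hbox (mem_box_of_agree hs (transfer_subset X B) hB),
    (isOpen_agree (transfer X A) (s.sup id)).preimage (continuous_transfer X), fun _ _ => Iff.rfl⟩

theorem not_forall_iterate_shift_lt {φ : InfSub → ℕ} {X : InfSub}
    (h : ∀ A : InfSub, A.1 ⊆ X.1 → φ A.shift < φ A) : False := by
  have hsub : ∀ n, (shift^[n] X).1 ⊆ X.1 := fun n => by
    induction n with
    | zero => exact subset_rfl
    | succ n ih =>
      rw [Function.iterate_succ_apply']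
      exact (shift_subset _).trans ih
  refine not_strictAnti_of_wellFoundedLT (fun n => φ (shift^[n] X))
    (strictAnti_nat_of_succ_lt fun n => ?_)
  simp only [Function.iterate_succ_apply']
  exact h _ (hsub n)

/-! ### The graph homomorphisms -/

section Graph

variable {P : ℕ → ℕ → Prop}

theorem existsContinuousHom_iff : ExistsContinuousHom (dirGraph shift) P ↔
    ∃ φ : InfSub → ℕ, Continuous φ ∧ ∀ A, P (φ A) (φ A.shift) :=
  ⟨fun ⟨h, hc⟩ => ⟨h, hc, fun A => h.map_rel ⟨A.ne_shift, rfl⟩⟩,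
    fun ⟨φ, hc, h⟩ => ⟨⟨φ, by rintro A _ ⟨-, rfl⟩; exact h A⟩, hc⟩⟩

theorem not_isBetterBinaryRelation_iff : ¬ IsBetterBinaryRelation (fun m n => ¬ P m n) ↔
    ∃ φ : InfSub → ℕ, Continuous φ ∧ ∀ A, P (φ A) (φ A.shift) := by
  simp only [IsBetterBinaryRelation]
  push Not
  rfl

theorem exists_lt_shift_of_hom (hP : ∀ n, ¬ P n n) {φ : InfSub → ℕ} (hc : Continuous φ)
    (hφ : ∀ A, P (φ A) (φ A.shift)) : ∃ ψ : InfSub → ℕ, Continuous ψ ∧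
      ∀ A, P (ψ A) (ψ A.shift) ∧ ψ A < ψ A.shift := by
  have hopen : IsOpen {A : InfSub | φ A < φ A.shift} :=
    (isOpen_discrete {p : ℕ × ℕ | p.1 < p.2}).preimage (hc.prodMk (hc.comp continuous_shift))
  obtain ⟨X, hX⟩ := exists_homogeneous_of_borel
    (MeasurableSpace.measurableSet_generateFrom hopen)
  -- Irreflexivity excludes equality, so the other alternative would give infinite descent.
  have hX := hX.resolve_right fun h => not_forall_iterate_shift_lt (φ := φ) fun A hA =>
    lt_of_le_of_ne (not_lt.1 (h A hA)) fun he => hP (φ A) (by simpa only [he] using hφ A)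
  exact ⟨fun A => φ (transfer X A), hc.comp (continuous_transfer X), fun A => by
    simp only [transfer_shift]
    exact ⟨hφ _, hX _ (transfer_subset X A)⟩⟩

theorem existsContinuousHom_unf (hP : ∀ n, ¬ P n n) {φ : InfSub → ℕ} (hc : Continuous φ)
    (hφ : ∀ A, P (φ A) (φ A.shift)) :
    ExistsContinuousHom (dirGraph shift) (restrictGraph (dirGraph shift) (unf P)) := by
  obtain ⟨ψ, hψc, hψ⟩ := exists_lt_shift_of_hom hP hc hφ
  have hmono : ∀ A, StrictMono fun i => ψ (shift^[i] A) := fun A =>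
    strictMono_nat_of_lt_succ fun i => by
      simp only [Function.iterate_succ_apply']
      exact (hψ _).2
  let f : InfSub → InfSub := fun A =>
    ⟨Set.range fun i => ψ (shift^[i] A), Set.infinite_range_of_injective (hmono A).injective⟩
  have hunf : ∀ A, f A ∈ unf P := fun A i => by
    rw [enum_eq_of_strictMono (hmono A) rfl]
    simp only [Function.iterate_succ_apply']
    exact (hψ _).1
  have hshift : ∀ A, (f A).shift = f A.shift := fun A =>
    Subtype.ext (shift_val_of_eq_range (hmono A) rfl)
  have hcont : Continuous f := continuous_iff_isClopen.2 fun n => by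
    -- Strict monotonicity gives `i ≤ ψ (shift^[i] A)`, so only `i ≤ n` can produce the value `n`.
    have : {A | n ∈ (f A).1} = ⋃ i ∈ Set.Iic n, {A | ψ (shift^[i] A) = n} := by
      ext A
      simp only [f, Set.mem_ofPred_eq, Set.mem_range, Set.mem_iUnion, Set.mem_Iic, exists_prop]
      exact ⟨fun ⟨i, hi⟩ => ⟨i, hi ▸ (hmono A).id_le i, hi⟩, fun ⟨i, _, hi⟩ => ⟨i, hi⟩⟩
    rw [this]
    exact (Set.finite_Iic n).isClopen_biUnion fun i _ =>
      (isClopen_discrete {n}).preimage (hψc.comp (continuous_shift.iterate i))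
  refine ⟨⟨fun A => ⟨f A, hunf A⟩, ?_⟩, hcont.subtype_mk _⟩
  rintro A _ ⟨-, rfl⟩
  exact ⟨by simpa only [← hshift] using (f A).ne_shift, hshift A⟩

theorem existsBorelHom_of_existsContinuousHom {Y : Set InfSub}
    (h : ExistsContinuousHom (dirGraph shift) (restrictGraph (dirGraph shift) Y)) :
    ExistsBorelHom (symGraph shift) (restrictGraph (symGraph shift) Y) := by
  obtain ⟨f, hf⟩ := h
  refine ⟨⟨f, ?_⟩, hf.borel_measurable⟩
  rintro A B ⟨hne, rfl | rfl⟩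
  · have := f.map_rel (⟨hne, rfl⟩ : dirGraph shift A A.shift)
    exact ⟨this.1, Or.inl this.2⟩
  · have := f.map_rel (⟨hne.symm, rfl⟩ : dirGraph shift B B.shift)
    exact ⟨this.1.symm, Or.inr this.2⟩

theorem exists_continuous_of_existsBorelHom
    (h : ExistsBorelHom (symGraph shift) (restrictGraph (symGraph shift) (unf P))) :
    ∃ φ : InfSub → ℕ, Continuous φ ∧ ∀ A, P (φ A) (φ A.shift) := by
  obtain ⟨f, hf⟩ := h
  let φ : InfSub → ℕ := fun A => sInf (f A).1.1
  have hφ : @Measurable InfSub ℕ (borel InfSub) ⊤ φ := by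
    have hs : Continuous fun B : unf P => sInf B.1.1 :=
      continuous_sInf.comp continuous_subtype_val
    borelize InfSub
    borelize ↥(unf P)
    exact hs.measurable.comp hf
  have hmeas : @MeasurableSet InfSub (borel InfSub) {A | φ A < φ A.shift} := by
    have hs := continuous_shift
    borelize InfSub
    exact measurableSet_lt hφ (hφ.comp hs.measurable)
  have hadj : ∀ A, (f A).1.shift = (f A.shift).1 ∨ (f A.shift).1.shift = (f A).1 := fun A =>
    (f.map_rel (⟨A.ne_shift, Or.inl rfl⟩ : symGraph shift A A.shift)).2
  obtain ⟨X, hX⟩ := exists_homogeneous_of_borel hmeas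
  -- A forward edge raises the minimum and a backward edge lowers it; always backward would descend
  -- forever.
  have hX := hX.resolve_right fun h => not_forall_iterate_shift_lt (φ := φ) fun A hA => by
    rcases hadj A with h' | h'
    · refine absurd ?_ (h A hA)
      simp only [φ, Set.mem_ofPred_eq, ← h']
      exact sInf_lt_sInf_shift _
    · simp only [φ, ← h']
      exact sInf_lt_sInf_shift _
  have hXP : ∀ A : InfSub, A.1 ⊆ X.1 → P (φ A) (φ A.shift) := fun A hA => by
    have hlt : φ A < φ A.shift := hX A hA
    rcases hadj A with h' | h'
    -- On a forward edge, the two minima are the first two elements of a member of `unf P`.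
    · have := (f A).2 0
      rwa [← enum_shift, enum_zero, enum_zero, h'] at this
    · refine absurd hlt (not_lt_of_gt ?_)
      simp only [φ, ← h']
      exact sInf_lt_sInf_shift _
  have hφX : @Measurable InfSub ℕ (borel InfSub) ⊤ fun A => φ (transfer X A) := by
    have ht := continuous_transfer X
    borelize InfSub
    exact hφ.comp ht.measurable
  obtain ⟨Z, hZ⟩ := exists_continuous_comp_transfer hφX
  refine ⟨_, hZ, fun A => ?_⟩
  simp only [transfer_shift]
  exact hXP _ (transfer_subset X _)

end Graph

end InfSub

theorem lemma3 (P : ℕ → ℕ → Prop) (hP : ∀ n, ¬ P n n) :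
    List.TFAE
      [¬ IsBetterBinaryRelation (fun m n => ¬ P m n),
       ExistsContinuousHom (dirGraph InfSub.shift) P,
       ExistsContinuousHom (dirGraph InfSub.shift)
         (restrictGraph (dirGraph InfSub.shift) (unf P)),
       ExistsBorelHom (symGraph InfSub.shift)
         (restrictGraph (symGraph InfSub.shift) (unf P))] := by
  tfae_have 1 ↔ 2 :=
    InfSub.not_isBetterBinaryRelation_iff.trans InfSub.existsContinuousHom_iff.symm
  tfae_have 2 → 3 := fun h => by
    obtain ⟨φ, hc, hφ⟩ := InfSub.existsContinuousHom_iff.1 h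
    exact InfSub.existsContinuousHom_unf hP hc hφ
  tfae_have 3 → 4 := InfSub.existsBorelHom_of_existsContinuousHom
  tfae_have 4 → 2 := fun h =>
    InfSub.existsContinuousHom_iff.2 (InfSub.exists_continuous_of_existsBorelHom h)
  tfae_finish
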